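/- For complex $c\notin\{0,-1,-2,\dots\}$ and $z\in\mathbb C$ let ${}_0F_1(c\mid z)=\sum_{n\ge0}\frac{z^n}{(c)_n\,n!}$, where $(c)_n=c(c+1)\cdots(c+n-1)$. Let $\mathrm{Ai}$ and $\mathrm{Bi}$ be the (entire) Airy functions, $$\mathrm{Ai}(z)=c_1f(z)-c_2g(z),\qquad \mathrm{Bi}(z)=\sqrt3\,\{c_1f(z)+c_2g(z)\},$$ with $f(z)={}_0F_1(\tfrac23\mid\tfrac{z^3}9)$, $g(z)=z\,{}_0F_1(\tfrac43\mid\tfrac{z^3}9)$, $c_1=3^{-2/3}/\Gamma(\tfrac23)$, $c_2=3^{-1/3}/\Gamma(\tfrac13)$. All the integrals below converge absolutely, and the following hold. (1) For all $a,b\in\mathbb C$, $$\int_{\mathbb R}e^{-t^2}\Big\{\mathrm{Ai}\big(2at-a[a^3+2b^3]\big)\mathrm{Bi}\big(2bt-b[2a^3+b^3]\big)+\mathrm{Ai}\big(2bt-b[2a^3+b^3]\big)\mathrm{Bi}\big(2at-a[a^3+2b^3]\big)\Big\}\,dt$$ $$=\frac{2}{12^{1/3}}\exp\Big(-\frac{(a^3+b^3)^2}{3}\Big)\Big\{\frac{1}{\Gamma(\frac56)}\,{}_0F_1\big(\tfrac56\mid\tfrac49(ab)^6\big)-\frac{2ab}{12^{1/3}\,\Gamma(\frac76)}\,{}_0F_1\big(\tfrac76\mid\tfrac49(ab)^6\big)\Big\}.$$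 For $ab\ne0$ these hypergeometric functions are modified Bessel functions $I_\nu(z)=(\tfrac z2)^{\nu}\sum_{n\ge0}\frac{(z^2/4)^n}{n!\,\Gamma(\nu+n+1)}$ of order $\nu=\mp\tfrac16$: with $w=\tfrac43(ab)^3$ and principal powers, $$\frac{1}{\Gamma(\frac56)}\,{}_0F_1\big(\tfrac56\mid\tfrac49(ab)^6\big)=\Big(\frac w2\Big)^{1/6}I_{-1/6}(w),\qquad \frac{1}{\Gamma(\frac76)}\,{}_0F_1\big(\tfrac76\mid\tfrac49(ab)^6\big)=\Big(\frac w2\Big)^{-1/6}I_{1/6}(w).$$ (2) For all $a\in\mathbb C$, $$\int_{\mathbb R}e^{-t^2}\mathrm{Ai}(2at+a^4)\,\mathrm{Bi}(-2at+a^4)\,dt=\frac{1}{12^{1/3}}\Big\{\frac{1}{\Gamma(\frac56)}\,{}_0F_1\big(\tfrac56\mid\tfrac49a^{12}\big)+\frac{2a^2}{12^{1/3}\,\Gamma(\frac76)}\,{}_0F_1\big(\tfrac76\mid\tfrac49a^{12}\big)\Big\}.$$ (3) For all $a\in\mathbb C$, $$\int_{\mathbb R}e^{-t^2}\mathrm{Bi}(2at+a^4)\,\mathrm{Bi}(-2at+a^4)\,dt=3\int_{\mathbb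 R}e^{-t^2}\mathrm{Ai}(2at+a^4)\,\mathrm{Ai}(-2at+a^4)\,dt$$ $$=\frac{\sqrt3}{12^{1/3}}\Big\{\frac{1}{\Gamma(\frac56)}\,{}_0F_1\big(\tfrac56\mid\tfrac49a^{12}\big)-\frac{2a^2}{12^{1/3}\,\Gamma(\frac76)}\,{}_0F_1\big(\tfrac76\mid\tfrac49a^{12}\big)\Big\}.$$ -/

import Mathlib

open MeasureTheory

noncomputable section

/-- The confluent hypergeometric limit function
`₀F₁(c | z) = ∑ₙ zⁿ / ((c)ₙ n!)`, with `(c)ₙ` the rising factorial. -/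
def hyp0F1 (c z : ℂ) : ℂ :=
  ∑' n : ℕ, z ^ n / ((ascPochhammer ℂ n).eval c * (n.factorial : ℂ))

/-- The Airy atom `f(z) = ₀F₁(2/3 | z³/9)`: the entire solution of `w'' = z w`
with `w(0) = 1`, `w'(0) = 0`. -/
def airyAtomF (z : ℂ) : ℂ := hyp0F1 (2 / 3) (z ^ 3 / 9)

/-- The Airy atom `g(z) = z ₀F₁(4/3 | z³/9)`: the entire solution of `w'' = z w`
with `w(0) = 0`, `w'(0) = 1`. -/
def airyAtomG (z : ℂ) : ℂ := z * hyp0F1 (4 / 3) (z ^ 3 / 9)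

/-- `Ai(0) = 3^(-2/3) / Γ(2/3)`. -/
def airyC₁ : ℂ := (3 : ℂ) ^ (-(2 / 3) : ℂ) / Complex.Gamma (2 / 3)

/-- `-Ai'(0) = 3^(-1/3) / Γ(1/3)`. -/
def airyC₂ : ℂ := (3 : ℂ) ^ (-(1 / 3) : ℂ) / Complex.Gamma (1 / 3)

/-- The Airy function `Ai` on the complex plane. -/
def airyAi (z : ℂ) : ℂ := airyC₁ * airyAtomF z - airyC₂ * airyAtomG z

/-- The Airy function `Bi` on the complex plane. -/
def airyBi (z : ℂ) : ℂ :=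
  ((Real.sqrt 3 : ℝ) : ℂ) * (airyC₁ * airyAtomF z + airyC₂ * airyAtomG z)

/-- The modified Bessel function of the first kind (principal branch),
`I_ν(z) = (z/2)^ν ∑ₙ (z²/4)ⁿ / (n! Γ(ν+n+1))`. -/
def besselI (ν z : ℂ) : ℂ :=
  (z / 2) ^ ν * ∑' n : ℕ, (z ^ 2 / 4) ^ n / ((n.factorial : ℂ) * Complex.Gamma (ν + n + 1))

end

/-! Let `u`, `v` be entire solutions of `w'' = z w` with growth below `exp (ε |z|²)` for every `ε`.
Scale `(a, b)` to `(s a, s b)` and let `P(s)` be the Gaussian integral of the product `u v`,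
normalised by `exp (s⁶ (a³ + b³)² / 3)`. The `s`-derivative of the integrand is reduced modulo total
derivatives `∂ₜ (e^{-t²} ψ)`, which integrate to zero; since `w'' = z w`, only the products `u v`,
`u v'`, `u' v`, `u' v'` occur. The shifts in the arguments and the exponential factor are exactly
those for which the reduction closes up on two functions: `P' = 4 s a b Q` and `Q' = 16 s⁹ (a b)⁵ P`
(`hasDerivAt_gaussAiry`, `hasDerivAt_gaussAiry'`).

In the variable `q = s² a b` this reads `d²P/dq² = 16 q⁴ P`, which is solved by `₀F₁(5/6 | 4q⁶/9)`
and `q ₀F₁(7/6 | 4q⁶/9)`. At `s = 0` the integrals are pure Gaussians, so `P` is determined by `u(0)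
v(0)` and `u'(0) v'(0)` alone (`gaussAiry_eq`). Every claimed integral is an instance with `u, v ∈
{Ai, Bi}` and `s = 1`.

What remains is the growth of the Airy functions, of order 3/2 (`norm_hyp0F1_le`), and the
evaluation of `c₁²` and `c₂²` by the reflection and duplication formulas for `Γ` (`airyC₁_sq`,
`airyC₂_sq`). -/

/-! ### The series `₀F₁`: convergence, derivative, differential equations. -/

theorem ascPochhammer_eval_succ_left (c : ℂ) (n : ℕ) :
    (ascPochhammer ℂ (n + 1)).eval c = c * (ascPochhammer ℂ n).eval (c + 1) := by
  simp [ascPochhammer_succ_left, Polynomial.eval_comp]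

/-- Each factor satisfies `|c + k| ≥ Re c + k ≥ δ (k + 1)`, the last step because `δ ≤ 1`. -/
theorem le_norm_ascPochhammer_eval {c : ℂ} {δ : ℝ} (h0 : 0 ≤ δ) (h1 : δ ≤ 1) (hc : δ ≤ c.re)
    (n : ℕ) : δ ^ n * n.factorial ≤ ‖(ascPochhammer ℂ n).eval c‖ := by
  induction n with
  | zero => simp
  | succ n ih =>
    rw [ascPochhammer_succ_eval, norm_mul, pow_succ, Nat.factorial_succ]
    have h : δ * (n + 1) ≤ ‖c + n‖ := by
      refine le_trans ?_ (Complex.re_le_norm _)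
      simp only [Complex.add_re, Complex.natCast_re]
      nlinarith [(Nat.cast_nonneg n : (0 : ℝ) ≤ n)]
    push_cast
    calc δ ^ n * δ * ((n + 1) * n.factorial) = (δ ^ n * n.factorial) * (δ * (n + 1)) := by ring
      _ ≤ _ := by gcongr

theorem ascPochhammer_eval_ne_zero {c : ℂ} (hc : 0 < c.re) (n : ℕ) :
    (ascPochhammer ℂ n).eval c ≠ 0 := by
  have h := le_norm_ascPochhammer_eval (c := c) (δ := min c.re 1) (by positivity)
    (min_le_right _ _) (min_le_left _ _) n
  have : 0 < (min c.re 1) ^ n * n.factorial := by positivity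
  exact norm_pos_iff.mp (this.trans_le h)

theorem norm_hyp0F1_term_le {c : ℂ} {δ : ℝ} (h0 : 0 < δ) (h1 : δ ≤ 1) (hc : δ ≤ c.re)
    (z : ℂ) (n : ℕ) :
    ‖z ^ n / ((ascPochhammer ℂ n).eval c * (n.factorial : ℂ))‖
      ≤ (‖z‖ / δ) ^ n / ((n.factorial : ℝ) * n.factorial) := by
  rw [norm_div, norm_mul, norm_pow, div_pow, div_div, Complex.norm_natCast]
  have h := le_norm_ascPochhammer_eval h0.le h1 hc n
  have : 0 < (n.factorial : ℝ) := by positivity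
  refine div_le_div_of_nonneg_left (by positivity) (by positivity) ?_
  calc δ ^ n * ((n.factorial : ℝ) * n.factorial) = δ ^ n * n.factorial * n.factorial := by ring
    _ ≤ _ := by gcongr

theorem norm_hyp0F1_term_le_exp_term {c : ℂ} (hc : 0 < c.re) {z : ℂ} {R : ℝ} (hz : ‖z‖ ≤ R)
    (n : ℕ) :
    ‖z ^ n / ((ascPochhammer ℂ n).eval c * (n.factorial : ℂ))‖
      ≤ (R / min c.re 1) ^ n / (n.factorial : ℝ) := by
  have hδ : 0 < min c.re 1 := by positivity
  refine (norm_hyp0F1_term_le hδ (min_le_right _ _) (min_le_left _ _) z n).trans ?_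
  have h1 : (1 : ℝ) ≤ n.factorial := by exact_mod_cast n.factorial_pos
  have hR : 0 ≤ R := (norm_nonneg z).trans hz
  refine div_le_div₀ (by positivity) (by gcongr) (by positivity) ?_
  nlinarith

theorem summable_hyp0F1 {c : ℂ} (hc : 0 < c.re) (z : ℂ) :
    Summable fun n : ℕ => z ^ n / ((ascPochhammer ℂ n).eval c * (n.factorial : ℂ)) :=
  Summable.of_norm_bounded (Real.summable_pow_div_factorial _)
    (norm_hyp0F1_term_le_exp_term hc le_rfl)

theorem differentiable_hyp0F1 {c : ℂ} (hc : 0 < c.re) : Differentiable ℂ (hyp0F1 c) := by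
  intro z
  have h := Complex.differentiableOn_tsum_of_summable_norm
    (F := fun (n : ℕ) (w : ℂ) => w ^ n / ((ascPochhammer ℂ n).eval c * (n.factorial : ℂ)))
    (U := Metric.ball 0 (‖z‖ + 1)) (Real.summable_pow_div_factorial ((‖z‖ + 1) / min c.re 1))
    (fun n => by fun_prop) Metric.isOpen_ball
    (fun n w hw => norm_hyp0F1_term_le_exp_term hc (by simpa using (mem_ball_zero_iff.mp hw).le) n)
  exact h.differentiableAt (Metric.isOpen_ball.mem_nhds (by simp))

theorem hasDerivAt_hyp0F1 {c : ℂ} (hc : 0 < c.re) (z : ℂ) :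
    HasDerivAt (hyp0F1 c) (1 / c * hyp0F1 (c + 1) z) z := by
  have hc0 : c ≠ 0 := by rintro rfl; simp at hc
  have hc1 : 0 < (c + 1).re := by simp; linarith
  have h := Complex.hasSum_deriv_of_summable_norm
    (F := fun (n : ℕ) (w : ℂ) => w ^ n / ((ascPochhammer ℂ n).eval c * (n.factorial : ℂ)))
    (U := Metric.ball 0 (‖z‖ + 1)) (Real.summable_pow_div_factorial ((‖z‖ + 1) / min c.re 1))
    (fun n => by fun_prop) Metric.isOpen_ball
    (fun n w hw => norm_hyp0F1_term_le_exp_term hc (by simpa using (mem_ball_zero_iff.mp hw).le) n)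
    (z := z) (by simp)
  have h2 : HasSum (fun n : ℕ => deriv (fun w : ℂ =>
      w ^ n / ((ascPochhammer ℂ n).eval c * (n.factorial : ℂ))) z) (1 / c * hyp0F1 (c + 1) z) := by
    rw [← hasSum_nat_add_iff' 1]
    have h3 := (summable_hyp0F1 hc1 z).hasSum.mul_left (1 / c)
    convert! h3 using 1
    · funext n
      have h4 := ascPochhammer_eval_ne_zero hc1 n
      have h5 : (n.factorial : ℂ) ≠ 0 := by exact_mod_cast n.factorial_ne_zero
      have h6 : (n : ℂ) + 1 ≠ 0 := by exact_mod_cast n.succ_ne_zero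
      simp only [deriv_div_const, deriv_pow_field, ascPochhammer_eval_succ_left,
        Nat.factorial_succ]
      push_cast
      field_simp
    · simp [hyp0F1]
  rw [h2.unique h]
  exact (differentiable_hyp0F1 hc z).hasDerivAt

/-- From `1/(c)ₙ - 1/(c+1)ₙ = n / (c (c+1)ₙ)`: the factor `n` cancels against `n!` and shifts the
index. Differentiating twice produces the parameter `c + 2`; this relation brings it back to `c`. -/
theorem hyp0F1_contiguous {c : ℂ} (hc : 0 < c.re) (z : ℂ) :
    hyp0F1 c z = hyp0F1 (c + 1) z + z / (c * (c + 1)) * hyp0F1 (c + 2) z := by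
  have hc0 : c ≠ 0 := by rintro rfl; simp at hc
  have hc1 : 0 < (c + 1).re := by simp; linarith
  have hc2 : 0 < (c + 2).re := by simp; linarith
  have hc10 : c + 1 ≠ 0 := by intro h; simp [h] at hc1
  have h : HasSum (fun n : ℕ => z ^ n / ((ascPochhammer ℂ n).eval c * (n.factorial : ℂ))
      - z ^ n / ((ascPochhammer ℂ n).eval (c + 1) * (n.factorial : ℂ)))
      (z / (c * (c + 1)) * hyp0F1 (c + 2) z) := by
    rw [← hasSum_nat_add_iff' 1]
    have h3 := (summable_hyp0F1 hc2 z).hasSum.mul_left (z / (c * (c + 1)))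
    convert! h3 using 1
    · funext n
      have e : c + 1 + 1 = c + 2 := by ring
      have h4 := ascPochhammer_eval_ne_zero hc2 n
      have h4' := ascPochhammer_eval_ne_zero hc1 n
      have h5 : (n.factorial : ℂ) ≠ 0 := by exact_mod_cast n.factorial_ne_zero
      have h6 : (n : ℂ) + 1 ≠ 0 := by exact_mod_cast n.succ_ne_zero
      have h8 : (c + 1) * (ascPochhammer ℂ n).eval (c + 2)
          = (ascPochhammer ℂ n).eval (c + 1) * (c + 1 + n) := by
        rw [← e, ← ascPochhammer_eval_succ_left, ascPochhammer_succ_eval]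
      have h9 : c + 1 + n ≠ 0 := by
        intro h; rw [h, mul_zero] at h8; exact mul_ne_zero hc10 h4 h8
      have h10 : (ascPochhammer ℂ n).eval (c + 1)
          = (c + 1) * (ascPochhammer ℂ n).eval (c + 2) / (c + 1 + n) := by
        rw [h8]; field_simp
      simp only [ascPochhammer_eval_succ_left, Nat.factorial_succ, e, h10]
      push_cast
      field_simp
      ring
    · simp [hyp0F1]
  have h' := ((summable_hyp0F1 hc z).hasSum.sub (summable_hyp0F1 hc1 z).hasSum).unique h
  rw [← h']
  simp [hyp0F1]

theorem hyp0F1_zero (c : ℂ) : hyp0F1 c 0 = 1 := by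
  rw [hyp0F1, tsum_eq_single 0]
  · simp
  · intro n hn; simp [hn]

/-- Both solutions of `y'' = κ k² z^(k-2) y`, written with `k = m + 2`. -/
theorem hasDerivAt_hyp0F1_pow {c : ℂ} (hc : 0 < c.re) (κ z : ℂ) (m : ℕ) :
    HasDerivAt (fun w => hyp0F1 c (κ * w ^ (m + 2)))
      (κ * (m + 2) / c * z ^ (m + 1) * hyp0F1 (c + 1) (κ * z ^ (m + 2))) z := by
  have h1 : HasDerivAt (fun w : ℂ => κ * w ^ (m + 2)) (κ * (((m + 2 : ℕ) : ℂ) * z ^ (m + 1))) z :=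
    (hasDerivAt_pow (m + 2) z).const_mul κ
  convert! (hasDerivAt_hyp0F1 hc (κ * z ^ (m + 2))).comp z h1 using 1
  push_cast
  ring

/-- With `k = m + 2`, `hcm` says `c = 1 - 1/k`, the value for which the first-order term of the
differential equation drops out. -/
theorem hasDerivAt_hyp0F1_pow_even {c : ℂ} {m : ℕ} (hc : 0 < c.re) (hcm : c * (m + 2) = m + 1)
    (κ z : ℂ) :
    HasDerivAt (fun w => κ * (m + 2) / c * w ^ (m + 1) * hyp0F1 (c + 1) (κ * w ^ (m + 2)))
      (κ * (m + 2) ^ 2 * z ^ m * hyp0F1 c (κ * z ^ (m + 2))) z := by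
  have hc0 : c ≠ 0 := by rintro rfl; simp at hc
  have hc1 : 0 < (c + 1).re := by simp; linarith
  have hc10 : c + 1 ≠ 0 := by intro h; simp [h] at hc1
  have h1 : HasDerivAt (fun w : ℂ => κ * (m + 2) / c * w ^ (m + 1))
      (κ * (m + 2) / c * (((m + 1 : ℕ) : ℂ) * z ^ m)) z :=
    (hasDerivAt_pow (m + 1) z).const_mul _
  convert! h1.mul (hasDerivAt_hyp0F1_pow hc1 κ z m) using 1
  rw [hyp0F1_contiguous hc]
  have e : c + 1 + 1 = c + 2 := by ring
  push_cast
  rw [← hcm, e]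
  field_simp
  ring

/-- Here `c = 1/k`, giving the solution that vanishes at the origin. Its derivative is again a plain
`₀F₁`, so `hasDerivAt_hyp0F1_pow` supplies the second derivative. -/
theorem hasDerivAt_mul_hyp0F1_pow {c : ℂ} {m : ℕ} (hc : 0 < c.re) (hcm : c * (m + 2) = 1)
    (κ z : ℂ) :
    HasDerivAt (fun w => w * hyp0F1 (c + 1) (κ * w ^ (m + 2))) (hyp0F1 c (κ * z ^ (m + 2))) z := by
  have hc0 : c ≠ 0 := by rintro rfl; simp at hc
  have hc1 : 0 < (c + 1).re := by simp; linarith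
  have hc10 : c + 1 ≠ 0 := by intro h; simp [h] at hc1
  have hm : (m : ℂ) + 2 ≠ 0 := right_ne_zero_of_mul (hcm ▸ one_ne_zero)
  convert! (hasDerivAt_id' z).mul (hasDerivAt_hyp0F1_pow hc1 κ z m) using 1
  have e : c + 1 + 1 = c + 2 := by ring
  rw [hyp0F1_contiguous hc, e]
  have hcm' : c = 1 / (m + 2) := by field_simp; exact hcm
  field_simp
  linear_combination (-(z * z ^ (m + 1) * hyp0F1 (c + 2) (κ * z ^ (m + 2)) * κ)) * hcm

/-! ### Growth conditions and Gaussian integrals with a parameter. -/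

/-- Growth of order below `exp (ε ‖z‖²)` for every `ε > 0`. -/
def HasSubquadraticExpGrowth (u : ℂ → ℂ) : Prop :=
  ∀ ε : ℝ, 0 < ε → ∃ C : ℝ, 0 ≤ C ∧ ∀ z, ‖u z‖ ≤ C * Real.exp (ε * ‖z‖ ^ 2)

/-- Growth of order below `exp (ε t²)` for every `ε > 0`, locally uniformly in a parameter. -/
def HasSubquadraticExpGrowthOn (φ : ℂ → ℝ → ℂ) : Prop :=
  ∀ R ε : ℝ, 0 < ε → ∃ C : ℝ, 0 ≤ C ∧ ∀ s t, ‖s‖ ≤ R → ‖φ s t‖ ≤ C * Real.exp (ε * t ^ 2)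

namespace HasSubquadraticExpGrowthOn

variable {φ ψ : ℂ → ℝ → ℂ}

theorem add (hφ : HasSubquadraticExpGrowthOn φ) (hψ : HasSubquadraticExpGrowthOn ψ) :
    HasSubquadraticExpGrowthOn fun s t => φ s t + ψ s t := by
  intro R ε hε
  obtain ⟨C, hC, h1⟩ := hφ R ε hε
  obtain ⟨D, hD, h2⟩ := hψ R ε hε
  refine ⟨C + D, by positivity, fun s t hs => ?_⟩
  rw [add_mul]
  exact (norm_add_le _ _).trans (add_le_add (h1 s t hs) (h2 s t hs))

theorem neg (hφ : HasSubquadraticExpGrowthOn φ) :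
    HasSubquadraticExpGrowthOn fun s t => -φ s t := by
  simpa [HasSubquadraticExpGrowthOn] using hφ

theorem sub (hφ : HasSubquadraticExpGrowthOn φ) (hψ : HasSubquadraticExpGrowthOn ψ) :
    HasSubquadraticExpGrowthOn fun s t => φ s t - ψ s t := by
  simpa [sub_eq_add_neg] using hφ.add hψ.neg

theorem mul (hφ : HasSubquadraticExpGrowthOn φ) (hψ : HasSubquadraticExpGrowthOn ψ) :
    HasSubquadraticExpGrowthOn fun s t => φ s t * ψ s t := by
  intro R ε hε
  obtain ⟨C, hC, h1⟩ := hφ R (ε / 2) (by positivity)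
  obtain ⟨D, hD, h2⟩ := hψ R (ε / 2) (by positivity)
  refine ⟨C * D, by positivity, fun s t hs => ?_⟩
  calc ‖φ s t * ψ s t‖ = ‖φ s t‖ * ‖ψ s t‖ := norm_mul _ _
    _ ≤ (C * Real.exp (ε / 2 * t ^ 2)) * (D * Real.exp (ε / 2 * t ^ 2)) := by
        gcongr
        · exact h1 s t hs
        · exact h2 s t hs
    _ = C * D * (Real.exp (ε / 2 * t ^ 2) * Real.exp (ε / 2 * t ^ 2)) := by ring
    _ = _ := by rw [← Real.exp_add]; ring_nf

theorem of_continuous {α : ℂ → ℂ} (hα : Continuous α) :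
    HasSubquadraticExpGrowthOn fun s _ => α s := by
  intro R ε hε
  obtain ⟨C, hC⟩ := (isCompact_closedBall (0 : ℂ) R).exists_bound_of_continuousOn hα.continuousOn
  refine ⟨max C 0, le_max_right _ _, fun s t hs => ?_⟩
  have h1 : ‖α s‖ ≤ max C 0 := (hC s (by simpa using hs)).trans (le_max_left _ _)
  have h2 : 1 ≤ Real.exp (ε * t ^ 2) := Real.one_le_exp (by positivity)
  nlinarith [le_max_right C 0]

theorem ofReal : HasSubquadraticExpGrowthOn fun _ t => (t : ℂ) := by
  intro R ε hε
  refine ⟨1 + 1 / ε, by positivity, fun s t _ => ?_⟩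
  have h2 : ε * t ^ 2 + 1 ≤ Real.exp (ε * t ^ 2) := Real.add_one_le_exp _
  have h3 : |t| ≤ 1 + t ^ 2 := by nlinarith [sq_abs t, sq_nonneg (|t| - 1)]
  rw [Complex.norm_real, Real.norm_eq_abs]
  calc |t| ≤ 1 + t ^ 2 := h3
    _ ≤ (1 + 1 / ε) * (ε * t ^ 2 + 1) := by
        have : (1 + 1 / ε) * (ε * t ^ 2 + 1) = 1 + t ^ 2 + ε * t ^ 2 + 1 / ε := by
          field_simp; ring
        rw [this]
        have : 0 ≤ ε * t ^ 2 + 1 / ε := by positivity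
        linarith
    _ ≤ _ := by gcongr

theorem comp_affine {u α β : ℂ → ℂ} (hu : HasSubquadraticExpGrowth u) (hα : Continuous α)
    (hβ : Continuous β) : HasSubquadraticExpGrowthOn fun s t => u (α s * t + β s) := by
  intro R ε hε
  obtain ⟨A, hA⟩ := (isCompact_closedBall (0 : ℂ) R).exists_bound_of_continuousOn hα.continuousOn
  obtain ⟨B, hB⟩ := (isCompact_closedBall (0 : ℂ) R).exists_bound_of_continuousOn hβ.continuousOn
  -- Chosen so that `δ · 2A² ≤ ε`; the `+ 1` keeps the denominator positive when `A = 0`.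
  set δ := ε / (2 * A ^ 2 + 1) with hδ
  have hδ0 : 0 < δ := by positivity
  obtain ⟨C, hC, h⟩ := hu δ hδ0
  refine ⟨C * Real.exp (δ * (2 * B ^ 2)), by positivity, fun s t hs => ?_⟩
  have h1 : ‖α s‖ ≤ A := hA s (by simpa using hs)
  have h2 : ‖β s‖ ≤ B := hB s (by simpa using hs)
  have h3 : ‖α s * t + β s‖ ≤ A * |t| + B := by
    refine (norm_add_le _ _).trans ?_
    rw [norm_mul, Complex.norm_real, Real.norm_eq_abs]
    gcongr
  have h4 : ‖α s * t + β s‖ ^ 2 ≤ 2 * A ^ 2 * t ^ 2 + 2 * B ^ 2 := by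
    calc ‖α s * t + β s‖ ^ 2 ≤ (A * |t| + B) ^ 2 := by gcongr
      _ ≤ 2 * (A * |t|) ^ 2 + 2 * B ^ 2 := by nlinarith [sq_nonneg (A * |t| - B)]
      _ = _ := by rw [mul_pow, sq_abs]; ring
  have h5 : δ * (2 * A ^ 2) ≤ ε := by
    rw [hδ, div_mul_eq_mul_div, div_le_iff₀ (by positivity)]
    nlinarith
  calc ‖u (α s * t + β s)‖ ≤ C * Real.exp (δ * ‖α s * t + β s‖ ^ 2) := h _
    _ ≤ C * Real.exp (δ * (2 * B ^ 2) + ε * t ^ 2) := by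
        gcongr
        nlinarith [sq_nonneg t, mul_le_mul_of_nonneg_left h4 hδ0.le,
          mul_le_mul_of_nonneg_right h5 (sq_nonneg t)]
    _ = _ := by rw [Real.exp_add]; ring

theorem norm_gaussian_mul_le {R C : ℝ}
    (hC : ∀ s t, ‖s‖ ≤ R → ‖φ s t‖ ≤ C * Real.exp (1 / 2 * t ^ 2)) {s : ℂ} (hs : ‖s‖ ≤ R) (t : ℝ) :
    ‖Complex.exp (-(t : ℂ) ^ 2) * φ s t‖ ≤ C * Real.exp (-(1 / 2) * t ^ 2) := by
  rw [norm_mul, ← Complex.ofReal_pow, ← Complex.ofReal_neg, Complex.norm_exp_ofReal]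
  calc Real.exp (-t ^ 2) * ‖φ s t‖ ≤ Real.exp (-t ^ 2) * (C * Real.exp (1 / 2 * t ^ 2)) := by
        gcongr; exact hC s t hs
    _ = C * (Real.exp (-t ^ 2) * Real.exp (1 / 2 * t ^ 2)) := by ring
    _ = _ := by rw [← Real.exp_add]; ring_nf

theorem integrable_gaussian_mul (hφ : HasSubquadraticExpGrowthOn φ) {s : ℂ}
    (hc : Continuous (φ s)) : Integrable fun t : ℝ => Complex.exp (-(t : ℂ) ^ 2) * φ s t := by
  obtain ⟨C, -, h⟩ := hφ ‖s‖ (1 / 2) (by norm_num)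
  refine ((integrable_exp_neg_mul_sq (b := 1 / 2) (by norm_num)).const_mul C).mono'
    (by fun_prop) (Filter.Eventually.of_forall fun t => ?_)
  exact norm_gaussian_mul_le h le_rfl t

theorem hasDerivAt_integral_gaussian_mul {φ' : ℂ → ℝ → ℂ} (hφ : HasSubquadraticExpGrowthOn φ)
    (hφ' : HasSubquadraticExpGrowthOn φ') (hc : ∀ s, Continuous (φ s))
    (hc' : ∀ s, Continuous (φ' s)) (hd : ∀ s t, HasDerivAt (fun r => φ r t) (φ' s t) s) (s : ℂ) :
    HasDerivAt (fun r => ∫ t : ℝ, Complex.exp (-(t : ℂ) ^ 2) * φ r t)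
      (∫ t : ℝ, Complex.exp (-(t : ℂ) ^ 2) * φ' s t) s := by
  obtain ⟨C, -, h⟩ := hφ' (‖s‖ + 1) (1 / 2) (by norm_num)
  refine (hasDerivAt_integral_of_dominated_loc_of_deriv_le
    (F := fun r (t : ℝ) => Complex.exp (-(t : ℂ) ^ 2) * φ r t)
    (bound := fun t => C * Real.exp (-(1 / 2) * t ^ 2)) (Metric.ball_mem_nhds s one_pos)
    (Filter.Eventually.of_forall fun r => ?_) (hφ.integrable_gaussian_mul (hc s)) ?_
    (Filter.Eventually.of_forall fun t r hr => ?_)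
    ((integrable_exp_neg_mul_sq (b := 1 / 2) (by norm_num)).const_mul C)
    (Filter.Eventually.of_forall fun t r _ => (hd r t).const_mul _)).2
  · have := hc r
    exact Continuous.aestronglyMeasurable (by fun_prop)
  · have := hc' s
    exact Continuous.aestronglyMeasurable (by fun_prop)
  · refine norm_gaussian_mul_le h ?_ t
    have h1 : ‖r - s‖ < 1 := by simpa [dist_eq_norm] using hr
    linarith [norm_le_norm_add_norm_sub' r s]

/-- The integrand is `∂ₜ (e^{-t²} ψ)`, and both it and its primitive are integrable. -/
theorem integral_gaussian_mul_deriv_sub {ψ' : ℂ → ℝ → ℂ} (hψ : HasSubquadraticExpGrowthOn ψ)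
    (hψ' : HasSubquadraticExpGrowthOn ψ') (s : ℂ) (hc' : Continuous (ψ' s))
    (hd : ∀ t : ℝ, HasDerivAt (ψ s) (ψ' s t) t) :
    ∫ t : ℝ, Complex.exp (-(t : ℂ) ^ 2) * (ψ' s t - 2 * t * ψ s t) = 0 := by
  have hc : Continuous (ψ s) := continuous_iff_continuousAt.mpr fun t => (hd t).continuousAt
  refine integral_eq_zero_of_hasDerivAt_of_integrable
    (f := fun t : ℝ => Complex.exp (-(t : ℂ) ^ 2) * ψ s t) (fun t => ?_) ?_
    (hψ.integrable_gaussian_mul hc)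
  · have h1 : HasDerivAt (fun z : ℂ => Complex.exp (-z ^ 2))
        (Complex.exp (-(t : ℂ) ^ 2) * (-(2 * t))) t := by
      simpa using ((hasDerivAt_pow 2 (t : ℂ)).fun_neg).cexp
    convert! h1.comp_ofReal.mul (hd t) using 1
    ring
  · exact integrable_gaussian_mul (φ := fun s t => ψ' s t - 2 * t * ψ s t)
      (hψ'.sub (((of_continuous continuous_const).mul ofReal).mul hψ)) (by fun_prop)

end HasSubquadraticExpGrowthOn

/-- Cauchy's estimate on the unit circle about `z`; since `(|z| + 1)² ≤ 2|z|² + 2`, the exponent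
`ε/2` for `u` becomes `ε` for its derivative. -/
theorem HasSubquadraticExpGrowth.deriv {u : ℂ → ℂ} (hu : HasSubquadraticExpGrowth u)
    (hd : Differentiable ℂ u) : HasSubquadraticExpGrowth (deriv u) := by
  intro ε hε
  obtain ⟨C, hC, h⟩ := hu (ε / 2) (by positivity)
  refine ⟨C * Real.exp ε, by positivity, fun z => ?_⟩
  have h1 : ‖_root_.deriv u z‖ ≤ (C * Real.exp ε * Real.exp (ε * ‖z‖ ^ 2)) / 1 := by
    refine Complex.norm_deriv_le_of_forall_mem_sphere_norm_le one_pos hd.diffContOnCl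
      fun w hw => (h w).trans ?_
    have h2 : ‖w‖ ≤ ‖z‖ + 1 := by
      have : ‖w - z‖ = 1 := by simpa [dist_eq_norm] using hw
      linarith [norm_le_norm_add_norm_sub' w z]
    rw [mul_assoc, ← Real.exp_add]
    gcongr
    have h3 : ‖w‖ ^ 2 ≤ 2 * ‖z‖ ^ 2 + 2 := by
      nlinarith [norm_nonneg w, norm_nonneg z, sq_nonneg (‖z‖ - 1)]
    nlinarith
  simpa using h1

/-- The mechanism behind both differential relations: `h` states that the derivative of the
normalised integrand equals `k χ` up to a total `t`-derivative, with `ψ` as certificate. -/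
theorem HasSubquadraticExpGrowthOn.hasDerivAt_exp_mul_integral
    {φ φ' ψ ψ' χ : ℂ → ℝ → ℂ} {k n n' : ℂ → ℂ}
    (hφ : HasSubquadraticExpGrowthOn φ) (hφ' : HasSubquadraticExpGrowthOn φ')
    (hψ : HasSubquadraticExpGrowthOn ψ) (hψ' : HasSubquadraticExpGrowthOn ψ')
    (hχ : HasSubquadraticExpGrowthOn χ)
    (cφ : ∀ s, Continuous (φ s)) (cφ' : ∀ s, Continuous (φ' s))
    (cψ' : ∀ s, Continuous (ψ' s)) (cχ : ∀ s, Continuous (χ s))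
    (dφ : ∀ s t, HasDerivAt (fun r => φ r t) (φ' s t) s)
    (dψ : ∀ s t, HasDerivAt (ψ s) (ψ' s t) t)
    (dn : ∀ s, HasDerivAt n (n' s) s)
    (h : ∀ s t, φ' s t + n' s * φ s t - k s * χ s t = ψ' s t - 2 * t * ψ s t) (s : ℂ) :
    HasDerivAt (fun r => Complex.exp (n r) * ∫ t : ℝ, Complex.exp (-(t : ℂ) ^ 2) * φ r t)
      (k s * (Complex.exp (n s) * ∫ t : ℝ, Complex.exp (-(t : ℂ) ^ 2) * χ s t)) s := by
  have h0 := integral_gaussian_mul_deriv_sub hψ hψ' s (cψ' s) (dψ s)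
  have i1 := hφ.integrable_gaussian_mul (cφ s)
  have i2 := hφ'.integrable_gaussian_mul (cφ' s)
  have i3 := hχ.integrable_gaussian_mul (cχ s)
  have h1 : ∫ t : ℝ, Complex.exp (-(t : ℂ) ^ 2) * (ψ' s t - 2 * t * ψ s t)
      = (∫ t : ℝ, Complex.exp (-(t : ℂ) ^ 2) * φ' s t)
        + n' s * (∫ t : ℝ, Complex.exp (-(t : ℂ) ^ 2) * φ s t)
        - k s * (∫ t : ℝ, Complex.exp (-(t : ℂ) ^ 2) * χ s t) := by
    have i4 : Integrable fun t : ℝ => Complex.exp (-(t : ℂ) ^ 2) * φ' s t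
        + n' s * (Complex.exp (-(t : ℂ) ^ 2) * φ s t) := i2.add (i1.const_mul _)
    rw [← integral_const_mul, ← integral_const_mul, ← integral_add i2 (i1.const_mul _),
      ← integral_sub i4 (i3.const_mul _)]
    congr 1
    funext t
    rw [← h]
    ring
  convert! (dn s).cexp.mul (hasDerivAt_integral_gaussian_mul hφ hφ' cφ cφ' dφ s) using 1
  linear_combination Complex.exp (n s) * (h1 - h0)

/-! ### Airy solutions along a scaled path. -/

/-- An entire solution `u` of `w'' = z w` of moderate growth, with derivative `u'`. -/
structure IsAirySolution (u u' : ℂ → ℂ) : Prop where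
  hasDerivAt : ∀ z, HasDerivAt u (u' z) z
  hasDerivAt' : ∀ z, HasDerivAt u' (z * u z) z
  growth : HasSubquadraticExpGrowth u

namespace IsAirySolution

theorem growth' {u u' : ℂ → ℂ} (hu : IsAirySolution u u') : HasSubquadraticExpGrowth u' := by
  have h : deriv u = u' := funext fun z => (hu.hasDerivAt z).deriv
  exact h ▸ hu.growth.deriv fun z => (hu.hasDerivAt z).differentiableAt

theorem continuous {u u' : ℂ → ℂ} (hu : IsAirySolution u u') : Continuous u :=
  continuous_iff_continuousAt.mpr fun z => (hu.hasDerivAt z).continuousAt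

theorem continuous' {u u' : ℂ → ℂ} (hu : IsAirySolution u u') : Continuous u' :=
  continuous_iff_continuousAt.mpr fun z => (hu.hasDerivAt' z).continuousAt

end IsAirySolution

/-- The argument of the first Airy factor along the path `s ↦ (s a, s b)`. -/
def airyPath (a b s t : ℂ) : ℂ := 2 * a * s * t + -(s ^ 4 * (a * (a ^ 3 + 2 * b ^ 3)))

theorem hasDerivAt_airyPath_left (a b s t : ℂ) :
    HasDerivAt (fun r => airyPath a b r t)
      (2 * a * t - 4 * s ^ 3 * (a * (a ^ 3 + 2 * b ^ 3))) s := by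
  have h1 : HasDerivAt (fun r : ℂ => 2 * a * r * t) (2 * a * t) s := by
    simpa using (((hasDerivAt_id s).const_mul (2 * a)).mul_const t)
  convert! h1.add ((hasDerivAt_pow 4 s).mul_const (a * (a ^ 3 + 2 * b ^ 3))).fun_neg using 1

theorem hasDerivAt_airyPath_right (a b s t : ℂ) :
    HasDerivAt (airyPath a b s) (2 * a * s) t := by
  have h : HasDerivAt (fun t : ℂ => 2 * a * s * t) (2 * a * s) t := by
    simpa using (hasDerivAt_id t).const_mul (2 * a * s)
  exact h.add_const (-(s ^ 4 * (a * (a ^ 3 + 2 * b ^ 3))))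

theorem HasSubquadraticExpGrowth.comp_airyPath {u : ℂ → ℂ} (hu : HasSubquadraticExpGrowth u)
    (a b : ℂ) : HasSubquadraticExpGrowthOn fun s t => u (airyPath a b s t) :=
  HasSubquadraticExpGrowthOn.comp_affine hu (α := fun s => 2 * a * s)
    (β := fun s => -(s ^ 4 * (a * (a ^ 3 + 2 * b ^ 3)))) (by fun_prop) (by fun_prop)

theorem HasSubquadraticExpGrowthOn.airyPath (a b : ℂ) :
    HasSubquadraticExpGrowthOn fun s t => airyPath a b s t := by
  unfold _root_.airyPath
  exact ((of_continuous (by fun_prop)).mul ofReal).add (of_continuous (by fun_prop))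

theorem HasDerivAt.comp_airyPath_left {w : ℂ → ℂ} {w' a b s t : ℂ}
    (h : HasDerivAt w w' (airyPath a b s t)) :
    HasDerivAt (fun r => w (airyPath a b r t))
      (w' * (2 * a * t - 4 * s ^ 3 * (a * (a ^ 3 + 2 * b ^ 3)))) s :=
  h.comp s (hasDerivAt_airyPath_left a b s t)

theorem HasDerivAt.comp_airyPath_right {w : ℂ → ℂ} {w' a b s : ℂ} {t : ℝ}
    (h : HasDerivAt w w' (airyPath a b s t)) :
    HasDerivAt (fun r : ℝ => w (airyPath a b s r)) (w' * (2 * a * s)) t :=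
  (h.comp (t : ℂ) (hasDerivAt_airyPath_right a b s t)).comp_ofReal

theorem continuous_airyPath_ofReal (a b s : ℂ) :
    Continuous fun t : ℝ => airyPath a b s t := by
  unfold airyPath; fun_prop

/-! ### The first-order system satisfied by the two Gaussian integrals. -/

section

variable {u u' v v' : ℂ → ℂ} (hu : IsAirySolution u u') (hv : IsAirySolution v v') (a b : ℂ)

/-- `exp(s⁶(a³+b³)²/3) ∫ e^{-t²} u v` along the path. -/
noncomputable def gaussAiry (u v : ℂ → ℂ) (a b s : ℂ) : ℂ :=
  Complex.exp (s ^ 6 * (a ^ 3 + b ^ 3) ^ 2 / 3) * ∫ t : ℝ, Complex.exp (-(t : ℂ) ^ 2) *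
    (u (airyPath a b s t) * v (airyPath b a s t))

/-- The companion integral, half the derivative of `gaussAiry` with respect to `s² a b`. -/
noncomputable def gaussAiry' (u u' v v' : ℂ → ℂ) (a b s : ℂ) : ℂ :=
  Complex.exp (s ^ 6 * (a ^ 3 + b ^ 3) ^ 2 / 3) * ∫ t : ℝ, Complex.exp (-(t : ℂ) ^ 2) *
    (u' (airyPath a b s t) * v' (airyPath b a s t)
      - (a * s) ^ 2 * (u (airyPath a b s t) * v' (airyPath b a s t))
      - (b * s) ^ 2 * (u' (airyPath a b s t) * v (airyPath b a s t))
      - (s ^ 2 * a * b) ^ 2 * (u (airyPath a b s t) * v (airyPath b a s t)))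

theorem hasDerivAt_gaussAiry_exponent (s : ℂ) :
    HasDerivAt (fun s : ℂ => s ^ 6 * (a ^ 3 + b ^ 3) ^ 2 / 3)
      (2 * s ^ 5 * (a ^ 3 + b ^ 3) ^ 2) s := by
  convert! ((hasDerivAt_pow 6 s).mul_const ((a ^ 3 + b ^ 3) ^ 2)).div_const 3 using 1
  push_cast
  ring

include hu hv

theorem hasDerivAt_gaussAiry (s : ℂ) :
    HasDerivAt (gaussAiry u v a b) (4 * s * a * b * gaussAiry' u u' v v' a b s) s := by
  have gu := hu.growth.comp_airyPath a b
  have gu' := hu.growth'.comp_airyPath a b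
  have gv := hv.growth.comp_airyPath b a
  have gv' := hv.growth'.comp_airyPath b a
  have gX := HasSubquadraticExpGrowthOn.airyPath a b
  have gY := HasSubquadraticExpGrowthOn.airyPath b a
  have gt := HasSubquadraticExpGrowthOn.ofReal
  have cX := continuous_airyPath_ofReal a b
  have cY := continuous_airyPath_ofReal b a
  have cu := hu.continuous
  have cu' := hu.continuous'
  have cv := hv.continuous
  have cv' := hv.continuous'
  refine HasSubquadraticExpGrowthOn.hasDerivAt_exp_mul_integral
    (φ := fun s t => u (airyPath a b s t) * v (airyPath b a s t))
    (φ' := fun s t => u' (airyPath a b s t) * (2 * a * t - 4 * s ^ 3 * (a * (a ^ 3 + 2 * b ^ 3)))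
        * v (airyPath b a s t)
      + u (airyPath a b s t) * (v' (airyPath b a s t)
        * (2 * b * t - 4 * s ^ 3 * (b * (b ^ 3 + 2 * a ^ 3)))))
    -- In `-2tψ` the first two terms reproduce the part of `φ'` linear in `t`. Their own
    -- derivatives, through `u'' = X u` and `v'' = Y v`, create `-4(a³ + b³) s² t u v`, which the
    -- third term cancels.
    (ψ := fun s t => -a * (u' (airyPath a b s t) * v (airyPath b a s t))
      - b * (u (airyPath a b s t) * v' (airyPath b a s t))
      - 2 * (a ^ 3 + b ^ 3) * s ^ 2 * (u (airyPath a b s t) * v (airyPath b a s t)))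
    (ψ' := fun s t => -a * (airyPath a b s t * u (airyPath a b s t) * (2 * a * s)
          * v (airyPath b a s t)
        + u' (airyPath a b s t) * (v' (airyPath b a s t) * (2 * b * s)))
      - b * (u' (airyPath a b s t) * (2 * a * s) * v' (airyPath b a s t)
        + u (airyPath a b s t) * (airyPath b a s t * v (airyPath b a s t) * (2 * b * s)))
      - 2 * (a ^ 3 + b ^ 3) * s ^ 2 * (u' (airyPath a b s t) * (2 * a * s) * v (airyPath b a s t)
        + u (airyPath a b s t) * (v' (airyPath b a s t) * (2 * b * s))))
    (χ := fun s t => u' (airyPath a b s t) * v' (airyPath b a s t)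
      - (a * s) ^ 2 * (u (airyPath a b s t) * v' (airyPath b a s t))
      - (b * s) ^ 2 * (u' (airyPath a b s t) * v (airyPath b a s t))
      - (s ^ 2 * a * b) ^ 2 * (u (airyPath a b s t) * v (airyPath b a s t)))
    (k := fun s => 4 * s * a * b)
    ?_ ?_ ?_ ?_ ?_ (fun s => ?_) (fun s => ?_) (fun s => ?_) (fun s => ?_) (fun s t => ?_)
    (fun s t => ?_) (hasDerivAt_gaussAiry_exponent a b) (fun s t => ?_) s
  iterate 5
    · repeat' first
        | assumption
        | refine HasSubquadraticExpGrowthOn.of_continuous ?_; fun_prop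
        | apply HasSubquadraticExpGrowthOn.sub
        | apply HasSubquadraticExpGrowthOn.add
        | apply HasSubquadraticExpGrowthOn.mul
  iterate 4
    · have := cX s
      have := cY s
      fun_prop
  · exact (hu.hasDerivAt _).comp_airyPath_left.mul (hv.hasDerivAt _).comp_airyPath_left
  · have du := (hu.hasDerivAt (airyPath a b s t)).comp_airyPath_right
    have du' := (hu.hasDerivAt' (airyPath a b s t)).comp_airyPath_right
    have dv := (hv.hasDerivAt (airyPath b a s t)).comp_airyPath_right
    have dv' := (hv.hasDerivAt' (airyPath b a s t)).comp_airyPath_right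
    exact (((du'.mul dv).const_mul (-a)).sub ((du.mul dv').const_mul b)).sub
      ((du.mul dv).const_mul _)
  -- With the four Airy values as independent variables, a polynomial identity is left.
  · generalize u (airyPath a b s t) = U, u' (airyPath a b s t) = U', v (airyPath b a s t) = V,
      v' (airyPath b a s t) = V'
    unfold airyPath
    ring

theorem hasDerivAt_gaussAiry' (s : ℂ) :
    HasDerivAt (gaussAiry' u u' v v' a b)
      (16 * s ^ 9 * (a * b) ^ 5 * gaussAiry u v a b s) s := by
  have gu := hu.growth.comp_airyPath a b
  have gu' := hu.growth'.comp_airyPath a b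
  have gv := hv.growth.comp_airyPath b a
  have gv' := hv.growth'.comp_airyPath b a
  have gX := HasSubquadraticExpGrowthOn.airyPath a b
  have gY := HasSubquadraticExpGrowthOn.airyPath b a
  have gt := HasSubquadraticExpGrowthOn.ofReal
  have cX := continuous_airyPath_ofReal a b
  have cY := continuous_airyPath_ofReal b a
  have cu := hu.continuous
  have cu' := hu.continuous'
  have cv := hv.continuous
  have cv' := hv.continuous'
  refine HasSubquadraticExpGrowthOn.hasDerivAt_exp_mul_integral
    (φ := fun s t => u' (airyPath a b s t) * v' (airyPath b a s t)
      - (a * s) ^ 2 * (u (airyPath a b s t) * v' (airyPath b a s t))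
      - (b * s) ^ 2 * (u' (airyPath a b s t) * v (airyPath b a s t))
      - (s ^ 2 * a * b) ^ 2 * (u (airyPath a b s t) * v (airyPath b a s t)))
    (φ' := fun s t =>
      (airyPath a b s t * u (airyPath a b s t)
          * (2 * a * t - 4 * s ^ 3 * (a * (a ^ 3 + 2 * b ^ 3))) * v' (airyPath b a s t)
        + u' (airyPath a b s t) * (airyPath b a s t * v (airyPath b a s t)
          * (2 * b * t - 4 * s ^ 3 * (b * (b ^ 3 + 2 * a ^ 3)))))
      - (2 * a ^ 2 * s * (u (airyPath a b s t) * v' (airyPath b a s t))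
        + (a * s) ^ 2 * (u' (airyPath a b s t)
            * (2 * a * t - 4 * s ^ 3 * (a * (a ^ 3 + 2 * b ^ 3))) * v' (airyPath b a s t)
          + u (airyPath a b s t) * (airyPath b a s t * v (airyPath b a s t)
            * (2 * b * t - 4 * s ^ 3 * (b * (b ^ 3 + 2 * a ^ 3))))))
      - (2 * b ^ 2 * s * (u' (airyPath a b s t) * v (airyPath b a s t))
        + (b * s) ^ 2 * (airyPath a b s t * u (airyPath a b s t)
            * (2 * a * t - 4 * s ^ 3 * (a * (a ^ 3 + 2 * b ^ 3))) * v (airyPath b a s t)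
          + u' (airyPath a b s t) * (v' (airyPath b a s t)
            * (2 * b * t - 4 * s ^ 3 * (b * (b ^ 3 + 2 * a ^ 3))))))
      - (4 * s ^ 3 * (a * b) ^ 2 * (u (airyPath a b s t) * v (airyPath b a s t))
        + (s ^ 2 * a * b) ^ 2 * (u' (airyPath a b s t)
            * (2 * a * t - 4 * s ^ 3 * (a * (a ^ 3 + 2 * b ^ 3))) * v (airyPath b a s t)
          + u (airyPath a b s t) * (v' (airyPath b a s t)
            * (2 * b * t - 4 * s ^ 3 * (b * (b ^ 3 + 2 * a ^ 3)))))))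
    -- Differentiating along the path brings down a factor linear in `t`, and so does each use of
    -- the Airy equation, so `φ'` contains `t²`. The coefficients of `u v'`, `u v` and `u' v` must
    -- therefore be linear in `t`.
    (ψ := fun s t =>
      (-2 * a ^ 2 * s * t + a ^ 2 * (3 * a ^ 3 + 5 * b ^ 3) * s ^ 4)
        * (u (airyPath a b s t) * v' (airyPath b a s t))
      + (-4 * (a * b) ^ 2 * s ^ 3 * t + 7 * (a * b) ^ 2 * (a ^ 3 + b ^ 3) * s ^ 6)
        * (u (airyPath a b s t) * v (airyPath b a s t))
      + (-2 * b ^ 2 * s * t + b ^ 2 * (5 * a ^ 3 + 3 * b ^ 3) * s ^ 4)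
        * (u' (airyPath a b s t) * v (airyPath b a s t))
      - (a ^ 3 + b ^ 3) * s ^ 2 * (u' (airyPath a b s t) * v' (airyPath b a s t)))
    (ψ' := fun s t =>
      (-2 * a ^ 2 * s * (u (airyPath a b s t) * v' (airyPath b a s t))
        + (-2 * a ^ 2 * s * t + a ^ 2 * (3 * a ^ 3 + 5 * b ^ 3) * s ^ 4)
        * (u' (airyPath a b s t) * (2 * a * s) * v' (airyPath b a s t)
          + u (airyPath a b s t) * (airyPath b a s t * v (airyPath b a s t) * (2 * b * s))))
      + (-4 * (a * b) ^ 2 * s ^ 3 * (u (airyPath a b s t) * v (airyPath b a s t))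
        + (-4 * (a * b) ^ 2 * s ^ 3 * t + 7 * (a * b) ^ 2 * (a ^ 3 + b ^ 3) * s ^ 6)
        * (u' (airyPath a b s t) * (2 * a * s) * v (airyPath b a s t)
          + u (airyPath a b s t) * (v' (airyPath b a s t) * (2 * b * s))))
      + (-2 * b ^ 2 * s * (u' (airyPath a b s t) * v (airyPath b a s t))
        + (-2 * b ^ 2 * s * t + b ^ 2 * (5 * a ^ 3 + 3 * b ^ 3) * s ^ 4)
        * (airyPath a b s t * u (airyPath a b s t) * (2 * a * s) * v (airyPath b a s t)
          + u' (airyPath a b s t) * (v' (airyPath b a s t) * (2 * b * s))))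
      - (a ^ 3 + b ^ 3) * s ^ 2
        * (airyPath a b s t * u (airyPath a b s t) * (2 * a * s) * v' (airyPath b a s t)
          + u' (airyPath a b s t) * (airyPath b a s t * v (airyPath b a s t) * (2 * b * s))))
    (χ := fun s t => u (airyPath a b s t) * v (airyPath b a s t))
    (k := fun s => 16 * s ^ 9 * (a * b) ^ 5)
    ?_ ?_ ?_ ?_ ?_ (fun s => ?_) (fun s => ?_) (fun s => ?_) (fun s => ?_) (fun s t => ?_)
    (fun s t => ?_) (hasDerivAt_gaussAiry_exponent a b) (fun s t => ?_) s
  iterate 5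
    · repeat' first
        | assumption
        | refine HasSubquadraticExpGrowthOn.of_continuous ?_; fun_prop
        | apply HasSubquadraticExpGrowthOn.sub
        | apply HasSubquadraticExpGrowthOn.add
        | apply HasSubquadraticExpGrowthOn.mul
  iterate 4
    · have := cX s
      have := cY s
      fun_prop
  · have du := (hu.hasDerivAt (airyPath a b s t)).comp_airyPath_left
    have du' := (hu.hasDerivAt' (airyPath a b s t)).comp_airyPath_left
    have dv := (hv.hasDerivAt (airyPath b a s t)).comp_airyPath_left
    have dv' := (hv.hasDerivAt' (airyPath b a s t)).comp_airyPath_left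
    have d1 (c : ℂ) : HasDerivAt (fun s : ℂ => (c * s) ^ 2) (2 * c ^ 2 * s) s := by
      convert! ((hasDerivAt_id' s).const_mul c).pow 2 using 1
      push_cast; ring
    have d2 : HasDerivAt (fun s : ℂ => (s ^ 2 * a * b) ^ 2) (4 * s ^ 3 * (a * b) ^ 2) s := by
      convert! (((hasDerivAt_pow 2 s).mul_const a).mul_const b).pow 2 using 1
      push_cast; ring
    exact (((du'.mul dv').sub ((d1 a).mul (du.mul dv'))).sub ((d1 b).mul (du'.mul dv))).sub
      (d2.mul (du.mul dv))
  · have du := (hu.hasDerivAt (airyPath a b s t)).comp_airyPath_right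
    have du' := (hu.hasDerivAt' (airyPath a b s t)).comp_airyPath_right
    have dv := (hv.hasDerivAt (airyPath b a s t)).comp_airyPath_right
    have dv' := (hv.hasDerivAt' (airyPath b a s t)).comp_airyPath_right
    have dl (c d : ℂ) : HasDerivAt (fun t : ℝ => c * (t : ℂ) + d) c t := by
      simpa using (((hasDerivAt_id (t : ℂ)).const_mul c).add_const d).comp_ofReal
    exact ((((dl _ _).mul (du.mul dv')).add ((dl _ _).mul (du.mul dv))).add
      ((dl _ _).mul (du'.mul dv))).sub ((du'.mul dv').const_mul _)
  · generalize u (airyPath a b s t) = U, u' (airyPath a b s t) = U', v (airyPath b a s t) = V,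
      v' (airyPath b a s t) = V'
    unfold airyPath
    ring

end

/-! ### Solving the system. -/

section

variable {u u' v v' : ℂ → ℂ}

theorem integral_cexp_neg_sq : ∫ t : ℝ, Complex.exp (-(t : ℂ) ^ 2) = ((√Real.pi : ℝ) : ℂ) := by
  have h := integral_gaussian 1
  rw [div_one] at h
  rw [← h, ← integral_complex_ofReal]
  congr 1
  funext t
  push_cast
  ring_nf

theorem gaussAiry_zero (a b : ℂ) : gaussAiry u v a b 0 = ((√Real.pi : ℝ) : ℂ) * (u 0 * v 0) := by
  simp [gaussAiry, airyPath, integral_mul_const, integral_cexp_neg_sq]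

theorem gaussAiry'_zero (a b : ℂ) :
    gaussAiry' u u' v v' a b 0 = ((√Real.pi : ℝ) : ℂ) * (u' 0 * v' 0) := by
  simp [gaussAiry', airyPath, integral_mul_const, integral_cexp_neg_sq]

/-- Integrals of a system of two linear first-order equations along a path `p`, from two solutions
of the corresponding second-order equation with Wronskian one. -/
theorem eq_of_hasDerivAt_of_wronskian {P Q y₁ y₁' y₂ y₂' r p p' : ℂ → ℂ}
    (hy₁ : ∀ z, HasDerivAt y₁ (y₁' z) z) (hy₁' : ∀ z, HasDerivAt y₁' (r z * y₁ z) z)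
    (hy₂ : ∀ z, HasDerivAt y₂ (y₂' z) z) (hy₂' : ∀ z, HasDerivAt y₂' (r z * y₂ z) z)
    (h₁ : y₁ 0 = 1) (h₁' : y₁' 0 = 0) (h₂ : y₂ 0 = 0) (h₂' : y₂' 0 = 1)
    (hp : ∀ s, HasDerivAt p (p' s) s) (hp0 : p 0 = 0)
    (hP : ∀ s, HasDerivAt P (p' s * Q s) s) (hQ : ∀ s, HasDerivAt Q (p' s * (r (p s) * P s)) s)
    (s : ℂ) : P s = P 0 * y₁ (p s) + Q 0 * y₂ (p s) := by
  have const {w : ℂ → ℂ} (h : ∀ z, HasDerivAt w 0 z) (z : ℂ) : w z = w 0 :=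
    is_const_of_deriv_eq_zero (fun z => (h z).differentiableAt) (fun z => (h z).deriv) z 0
  have hW := const (w := fun z => y₁ z * y₂' z - y₂ z * y₁' z) (fun z => by
    convert! ((hy₁ z).mul (hy₂' z)).sub ((hy₂ z).mul (hy₁' z)) using 1
    ring) (p s)
  -- The coefficients of `P` in the basis `y₁ ∘ p`, `y₂ ∘ p` are constants of motion. Working along
  -- the path avoids inverting `p`, which may be constant.
  have hα := const (w := fun s => P s * y₂' (p s) - Q s * y₂ (p s)) (fun z => by
    convert! ((hP z).mul ((hy₂' (p z)).comp z (hp z))).sub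
      ((hQ z).mul ((hy₂ (p z)).comp z (hp z))) using 1
    simp only [Function.comp_apply]
    ring) s
  have hβ := const (w := fun s => Q s * y₁ (p s) - P s * y₁' (p s)) (fun z => by
    convert! ((hQ z).mul ((hy₁ (p z)).comp z (hp z))).sub
      ((hP z).mul ((hy₁' (p z)).comp z (hp z))) using 1
    simp only [Function.comp_apply]
    ring) s
  simp only [hp0, h₁, h₁', h₂, h₂'] at hW hα hβ
  linear_combination (-P s) * hW + y₁ (p s) * hα + y₂ (p s) * hβ

/-- In `q = s² a b` the pair `(P, 2Q)` satisfies `dP/dq = 2Q`, `d(2Q)/dq = 16 q⁴ P`; the exponent `k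
= 6` and `κ = 4/9` give `κ k² = 16`. The case `a b = 0` is included. -/
theorem gaussAiry_eq (hu : IsAirySolution u u') (hv : IsAirySolution v v') (a b s : ℂ) :
    gaussAiry u v a b s = ((√Real.pi : ℝ) : ℂ) *
      (u 0 * v 0 * hyp0F1 (5 / 6) (4 / 9 * (s ^ 2 * a * b) ^ 6)
      + 2 * (u' 0 * v' 0) * ((s ^ 2 * a * b) * hyp0F1 (7 / 6) (4 / 9 * (s ^ 2 * a * b) ^ 6))) := by
  have e : (1 / 6 + 1 : ℂ) = 7 / 6 := by norm_num
  have e5 : 0 < (5 / 6 : ℂ).re := by norm_num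
  have e1 : 0 < (1 / 6 : ℂ).re := by norm_num
  have e7 : 0 < (7 / 6 : ℂ).re := by norm_num
  have hy₁ (z : ℂ) := hasDerivAt_hyp0F1_pow e5 (4 / 9) z 4
  have hy₁' (z : ℂ) := hasDerivAt_hyp0F1_pow_even e5 (m := 4) (by norm_num) (4 / 9) z
  have hy₂ (z : ℂ) := hasDerivAt_mul_hyp0F1_pow e1 (m := 4) (by norm_num) (4 / 9) z
  have hy₂' (z : ℂ) := hasDerivAt_hyp0F1_pow e1 (4 / 9) z 4
  simp only [e] at hy₂ hy₂'
  have hp (s : ℂ) : HasDerivAt (fun s : ℂ => s ^ 2 * a * b) (2 * s * a * b) s := by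
    simpa using ((hasDerivAt_pow 2 s).mul_const a).mul_const b
  have h := eq_of_hasDerivAt_of_wronskian (P := gaussAiry u v a b)
    (Q := fun s => 2 * gaussAiry' u u' v v' a b s) (r := fun z => 16 * z ^ 4)
    hy₁ (fun z => (hy₁' z).congr_deriv (by norm_num)) hy₂
    (fun z => (hy₂' z).congr_deriv (by push_cast; ring)) (by simp [hyp0F1_zero]) (by simp)
    (by simp) (by simp [hyp0F1_zero]) hp (by simp)
    (fun s => (hasDerivAt_gaussAiry hu hv a b s).congr_deriv (by ring))
    (fun s => ((hasDerivAt_gaussAiry' hu hv a b s).const_mul 2).congr_deriv (by ring)) s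
  rw [h, gaussAiry_zero, gaussAiry'_zero]
  ring

theorem integrable_gaussian_airy (hu : HasSubquadraticExpGrowth u) (hv : HasSubquadraticExpGrowth v)
    (cu : Continuous u) (cv : Continuous v) (α β γ δ : ℂ) :
    Integrable fun t : ℝ => Complex.exp (-(t : ℂ) ^ 2) * (u (α * t + β) * v (γ * t + δ)) :=
  HasSubquadraticExpGrowthOn.integrable_gaussian_mul (s := 0)
    ((HasSubquadraticExpGrowthOn.comp_affine hu (continuous_const (y := α))
      (continuous_const (y := β))).mul (HasSubquadraticExpGrowthOn.comp_affine hv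
      (continuous_const (y := γ)) (continuous_const (y := δ)))) (by fun_prop)

theorem integral_gaussian_airy (hu : IsAirySolution u u') (hv : IsAirySolution v v') (a b : ℂ) :
    ∫ t : ℝ, Complex.exp (-(t : ℂ) ^ 2) * (u (2 * a * t + -(a * (a ^ 3 + 2 * b ^ 3)))
        * v (2 * b * t + -(b * (2 * a ^ 3 + b ^ 3))))
      = ((√Real.pi : ℝ) : ℂ) * Complex.exp (-(a ^ 3 + b ^ 3) ^ 2 / 3) *
      (u 0 * v 0 * hyp0F1 (5 / 6) (4 / 9 * (a * b) ^ 6)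
      + 2 * (u' 0 * v' 0) * (a * b * hyp0F1 (7 / 6) (4 / 9 * (a * b) ^ 6))) := by
  have h := gaussAiry_eq hu hv a b 1
  simp only [gaussAiry, airyPath, one_pow, one_mul, mul_one] at h
  have e : Complex.exp (-(a ^ 3 + b ^ 3) ^ 2 / 3) * Complex.exp ((a ^ 3 + b ^ 3) ^ 2 / 3) = 1 := by
    rw [← Complex.exp_add, neg_div, neg_add_cancel, Complex.exp_zero]
  simp only [add_comm (2 * a ^ 3) (b ^ 3)]
  linear_combination Complex.exp (-(a ^ 3 + b ^ 3) ^ 2 / 3) * h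
    - (∫ t : ℝ, Complex.exp (-(t : ℂ) ^ 2) * (u (2 * a * t + -(a * (a ^ 3 + 2 * b ^ 3)))
        * v (2 * b * t + -(b * (b ^ 3 + 2 * a ^ 3))))) * e

end

/-! ### The Airy atoms: growth and differential equation. -/

/-- Since `(2n)! ≤ 4ⁿ (n!)²`, the series is dominated termwise by that of `cosh √(4|z|/δ)`. The
square root is what gives the Airy functions order 3/2. -/
theorem norm_hyp0F1_le {c : ℂ} {δ : ℝ} (h0 : 0 < δ) (h1 : δ ≤ 1) (hc : δ ≤ c.re) (z : ℂ) :
    ‖hyp0F1 c z‖ ≤ Real.exp √(4 * ‖z‖ / δ) := by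
  have hs := Real.hasSum_cosh √(4 * ‖z‖ / δ)
  refine (tsum_of_norm_bounded hs fun n => ?_).trans ?_
  · refine (norm_hyp0F1_term_le h0 h1 hc z n).trans ?_
    rw [pow_mul, Real.sq_sqrt (by positivity), div_le_div_iff₀ (by positivity) (by positivity)]
    have h2 : (2 * n).factorial ≤ 4 ^ n * (n.factorial * n.factorial) := by
      have h3 := Nat.choose_mul_factorial_mul_factorial (show n ≤ 2 * n by omega)
      have h4 : (2 * n).choose n ≤ 4 ^ n := by
        calc (2 * n).choose n ≤ 2 ^ (2 * n) := Nat.choose_le_two_pow _ _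
          _ = 4 ^ n := by rw [pow_mul]; norm_num
      rw [show 2 * n - n = n by omega, mul_assoc] at h3
      rw [← h3]
      gcongr
    have h2' : ((2 * n).factorial : ℝ) ≤ 4 ^ n * (n.factorial * n.factorial) := by exact_mod_cast h2
    calc (‖z‖ / δ) ^ n * ((2 * n).factorial : ℝ)
        ≤ (‖z‖ / δ) ^ n * (4 ^ n * (n.factorial * n.factorial)) := by gcongr
      _ = (4 * ‖z‖ / δ) ^ n * (n.factorial * n.factorial) := by
        rw [mul_div_assoc, mul_pow]; ring
  · rw [Real.cosh_eq]
    have : Real.exp (-√(4 * ‖z‖ / δ)) ≤ Real.exp √(4 * ‖z‖ / δ) :=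
      Real.exp_le_exp.mpr (by linarith [Real.sqrt_nonneg (4 * ‖z‖ / δ)])
    linarith

theorem hasSubquadraticExpGrowth_hyp0F1 {c : ℂ} (hc : 2 / 3 ≤ c.re) :
    HasSubquadraticExpGrowth fun z => hyp0F1 c (z ^ 3 / 9) := by
  intro ε hε
  refine ⟨Real.exp (1 / (8 * ε ^ 3)), by positivity, fun z => ?_⟩
  refine (norm_hyp0F1_le (δ := 2 / 3) (by norm_num) (by norm_num) hc _).trans ?_
  rw [← Real.exp_add]
  gcongr
  refine Real.sqrt_le_iff.mpr ⟨by positivity, ?_⟩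
  have h1 : 4 * ‖z ^ 3 / 9‖ / (2 / 3) ≤ ‖z‖ ^ 3 := by
    have : ‖(9 : ℂ)‖ = 9 := by simp
    rw [norm_div, norm_pow, this]
    have : 0 ≤ ‖z‖ ^ 3 := by positivity
    linarith
  refine h1.trans ?_
  generalize ‖z‖ = x
  -- The constant `1/(8ε³)` makes the cross term `x²/(4ε²)`, which completes the square with `ε² x⁴
  -- - x³`.
  have h2 : (1 / (8 * ε ^ 3) + ε * x ^ 2) ^ 2 - x ^ 3
      = (1 / (8 * ε ^ 3)) ^ 2 + (ε * x ^ 2 - x / (2 * ε)) ^ 2 := by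
    field_simp
    ring
  have : 0 ≤ (1 / (8 * ε ^ 3)) ^ 2 + (ε * x ^ 2 - x / (2 * ε)) ^ 2 := by positivity
  linarith

theorem HasSubquadraticExpGrowth.id_mul {u : ℂ → ℂ} (hu : HasSubquadraticExpGrowth u) :
    HasSubquadraticExpGrowth fun z => z * u z := by
  intro ε hε
  obtain ⟨C, hC, h⟩ := hu (ε / 2) (by positivity)
  obtain ⟨D, hD, h'⟩ := HasSubquadraticExpGrowthOn.ofReal 0 (ε / 2) (by positivity)
  refine ⟨D * C, by positivity, fun z => ?_⟩
  have h1 : ‖z‖ ≤ D * Real.exp (ε / 2 * ‖z‖ ^ 2) := by simpa using h' 0 ‖z‖ (by simp)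
  calc ‖z * u z‖ = ‖z‖ * ‖u z‖ := norm_mul _ _
    _ ≤ (D * Real.exp (ε / 2 * ‖z‖ ^ 2)) * (C * Real.exp (ε / 2 * ‖z‖ ^ 2)) := by
      gcongr
      exact h z
    _ = D * C * (Real.exp (ε / 2 * ‖z‖ ^ 2) * Real.exp (ε / 2 * ‖z‖ ^ 2)) := by ring
    _ = _ := by rw [← Real.exp_add]; ring_nf

theorem isAirySolution_airyAtomF : IsAirySolution airyAtomF
    (fun z => z ^ 2 / 2 * hyp0F1 (5 / 3) (z ^ 3 / 9)) := by
  have e : (2 / 3 + 1 : ℂ) = 5 / 3 := by norm_num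
  have e2 : 0 < (2 / 3 : ℂ).re := by norm_num
  have e3 (z : ℂ) : 1 / 9 * z ^ 3 = z ^ 3 / 9 := by ring
  refine ⟨fun z => ?_, fun z => ?_, hasSubquadraticExpGrowth_hyp0F1 (by norm_num)⟩
  · have h := hasDerivAt_hyp0F1_pow e2 (1 / 9) z 1
    norm_num only [e, e3] at h
    convert! h using 1
    ring_nf
  · have h := hasDerivAt_hyp0F1_pow_even e2 (m := 1) (by norm_num) (1 / 9) z
    norm_num only [e, e3] at h
    convert! h using 1
    · funext w; ring_nf
    · simp [airyAtomF]

theorem isAirySolution_airyAtomG : IsAirySolution airyAtomG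
    (fun z => hyp0F1 (1 / 3) (z ^ 3 / 9)) := by
  have e : (1 / 3 + 1 : ℂ) = 4 / 3 := by norm_num
  have e2 : 0 < (1 / 3 : ℂ).re := by norm_num
  have e3 (z : ℂ) : 1 / 9 * z ^ 3 = z ^ 3 / 9 := by ring
  refine ⟨fun z => ?_, fun z => ?_, (hasSubquadraticExpGrowth_hyp0F1 (by norm_num)).id_mul⟩
  · have h := hasDerivAt_mul_hyp0F1_pow e2 (m := 1) (by norm_num) (1 / 9) z
    norm_num only [e, e3] at h
    exact h
  · have h := hasDerivAt_hyp0F1_pow e2 (1 / 9) z 1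
    norm_num only [e, e3] at h
    convert! h using 1
    simp only [airyAtomG]
    ring_nf

/-! ### Gamma identities and the Airy constants. -/

theorem Gamma_one_third_mul_Gamma_two_thirds :
    Complex.Gamma (1 / 3) * Complex.Gamma (2 / 3) * ((√3 : ℝ) : ℂ) = 2 * (Real.pi : ℂ) := by
  have h := Complex.Gamma_mul_Gamma_one_sub (1 / 3)
  have h1 : Complex.sin (Real.pi * (1 / 3)) = ((√3 : ℝ) : ℂ) / 2 := by
    have := congrArg (fun x : ℝ => (x : ℂ)) Real.sin_pi_div_three
    push_cast at this
    rw [← this]; ring_nf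
  have h2 : ((√3 : ℝ) : ℂ) ≠ 0 := by simp
  rw [h1, show (1 - 1 / 3 : ℂ) = 2 / 3 by norm_num] at h
  rw [h]
  field_simp

/-- Legendre duplication at `1/3`; this is where `Γ(5/6)` enters. -/
theorem Gamma_one_third_mul_Gamma_five_sixths :
    Complex.Gamma (1 / 3) * Complex.Gamma (5 / 6)
      = Complex.Gamma (2 / 3) * (2 : ℂ) ^ (1 / 3 : ℂ) * ((√Real.pi : ℝ) : ℂ) := by
  have h := Complex.Gamma_mul_Gamma_add_half (1 / 3)
  norm_num at h ⊢
  exact h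

/-- Legendre duplication at `2/3`, with `Γ(4/3) = Γ(1/3)/3`. -/
theorem Gamma_two_thirds_mul_Gamma_seven_sixths :
    3 * (Complex.Gamma (2 / 3) * Complex.Gamma (7 / 6)) * (2 : ℂ) ^ (1 / 3 : ℂ)
      = Complex.Gamma (1 / 3) * ((√Real.pi : ℝ) : ℂ) := by
  have h := Complex.Gamma_mul_Gamma_add_half (2 / 3)
  have h1 := Complex.Gamma_add_one (1 / 3) (by norm_num)
  have h2 : (2 : ℂ) ^ (-(1 / 3) : ℂ) * (2 : ℂ) ^ (1 / 3 : ℂ) = 1 := by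
    rw [← Complex.cpow_add _ _ two_ne_zero]; simp
  rw [show (2 / 3 + 1 / 2 : ℂ) = 7 / 6 by norm_num, show (2 * (2 / 3) : ℂ) = 1 / 3 + 1 by norm_num,
    show (1 - (1 / 3 + 1) : ℂ) = -(1 / 3) by norm_num, h1] at h
  rw [h]
  linear_combination Complex.Gamma (1 / 3) * ((√Real.pi : ℝ) : ℂ) * h2

theorem cpow_one_third_pow_three (z : ℂ) : (z ^ (1 / 3 : ℂ)) ^ 3 = z := by
  have h := Complex.cpow_nat_inv_pow z (n := 3) (by norm_num)
  rw [one_div]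
  exact_mod_cast h

theorem twelve_cpow_one_third :
    (12 : ℂ) ^ (1 / 3 : ℂ) = ((2 : ℂ) ^ (1 / 3 : ℂ)) ^ 2 * (3 : ℂ) ^ (1 / 3 : ℂ) := by
  have h1 := Complex.mul_cpow_ofReal_nonneg (a := 4) (b := 3) (by norm_num) (by norm_num) (1 / 3)
  have h2 := Complex.mul_cpow_ofReal_nonneg (a := 2) (b := 2) (by norm_num) (by norm_num) (1 / 3)
  push_cast at h1 h2
  norm_num only at h1 h2
  rw [h1, h2, sq]

theorem three_cpow_ne_zero : (3 : ℂ) ^ (1 / 3 : ℂ) ≠ 0 := by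
  simp [Complex.cpow_eq_zero_iff]

theorem two_cpow_ne_zero : (2 : ℂ) ^ (1 / 3 : ℂ) ≠ 0 := by
  simp [Complex.cpow_eq_zero_iff]

theorem sqrt_three_ofReal_sq : ((√3 : ℝ) : ℂ) ^ 2 = 3 := by
  rw [← Complex.ofReal_pow, Real.sq_sqrt (by norm_num)]; norm_num

theorem sqrt_pi_ofReal_sq : ((√Real.pi : ℝ) : ℂ) ^ 2 = Real.pi := by
  rw [← Complex.ofReal_pow, Real.sq_sqrt Real.pi_pos.le]

/-- The left side is `√π Ai(0) Bi(0)`, the coefficient of the first solution for the product `Ai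
Bi`. -/
theorem airyC₁_sq :
    airyC₁ ^ 2 * ((√3 : ℝ) : ℂ) * ((√Real.pi : ℝ) : ℂ)
      = 1 / (12 : ℂ) ^ (1 / 3 : ℂ) * (1 / Complex.Gamma (5 / 6)) := by
  have hG1 : Complex.Gamma (1 / 3) ≠ 0 := Complex.Gamma_ne_zero_of_re_pos (by norm_num)
  have hG2 : Complex.Gamma (2 / 3) ≠ 0 := Complex.Gamma_ne_zero_of_re_pos (by norm_num)
  have hG5 : Complex.Gamma (5 / 6) ≠ 0 := Complex.Gamma_ne_zero_of_re_pos (by norm_num)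
  have h1 := Gamma_one_third_mul_Gamma_two_thirds
  have h2 := Gamma_one_third_mul_Gamma_five_sixths
  have h3 : (3 : ℂ) ^ (-(2 / 3) : ℂ) = (((3 : ℂ) ^ (1 / 3 : ℂ)) ^ 2)⁻¹ := by
    rw [Complex.cpow_neg, ← Complex.cpow_nat_mul]; norm_num
  have hα := cpow_one_third_pow_three 2
  have hβ := cpow_one_third_pow_three 3
  have hα0 := two_cpow_ne_zero
  have hβ0 := three_cpow_ne_zero
  have hr := sqrt_three_ofReal_sq
  have hr0 : ((√3 : ℝ) : ℂ) ≠ 0 := by simp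
  rw [← sqrt_pi_ofReal_sq] at h1
  rw [airyC₁, h3, twelve_cpow_one_third]
  -- The roots are kept only through `α³ = 2`, `β³ = 3`, `r² = 3`, and `π` as `p²`, so that the
  -- claim becomes algebraic.
  generalize (2 : ℂ) ^ (1 / 3 : ℂ) = α at *
  generalize (3 : ℂ) ^ (1 / 3 : ℂ) = β at *
  generalize ((√3 : ℝ) : ℂ) = r at *
  generalize ((√Real.pi : ℝ) : ℂ) = p at *
  generalize Complex.Gamma (1 / 3) = G1 at *
  generalize Complex.Gamma (2 / 3) = G2 at *
  generalize Complex.Gamma (5 / 6) = G5 at *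
  have key : r * p * α ^ 2 * G5 = 3 * G2 ^ 2 := by
    apply mul_left_cancel₀ (mul_ne_zero hG1 hr0)
    linear_combination r ^ 2 * p * α ^ 2 * h2 - 3 * G2 * h1 + r ^ 2 * p ^ 2 * G2 * hα
      + 2 * p ^ 2 * G2 * hr
  field_simp
  linear_combination key - G2 ^ 2 * hβ

/-- The counterpart for `-√π Ai'(0) Bi'(0)`. -/
theorem airyC₂_sq :
    airyC₂ ^ 2 * ((√3 : ℝ) : ℂ) * ((√Real.pi : ℝ) : ℂ)
      = 1 / (12 : ℂ) ^ (1 / 3 : ℂ) * (1 / ((12 : ℂ) ^ (1 / 3 : ℂ) * Complex.Gamma (7 / 6))) := by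
  have hG1 : Complex.Gamma (1 / 3) ≠ 0 := Complex.Gamma_ne_zero_of_re_pos (by norm_num)
  have hG2 : Complex.Gamma (2 / 3) ≠ 0 := Complex.Gamma_ne_zero_of_re_pos (by norm_num)
  have hG7 : Complex.Gamma (7 / 6) ≠ 0 := Complex.Gamma_ne_zero_of_re_pos (by norm_num)
  have h1 := Gamma_one_third_mul_Gamma_two_thirds
  have h2 := Gamma_two_thirds_mul_Gamma_seven_sixths
  have h3 : (3 : ℂ) ^ (-(1 / 3) : ℂ) = ((3 : ℂ) ^ (1 / 3 : ℂ))⁻¹ := Complex.cpow_neg _ _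
  have hα := cpow_one_third_pow_three 2
  have hβ := cpow_one_third_pow_three 3
  have hα0 := two_cpow_ne_zero
  have hβ0 := three_cpow_ne_zero
  have hr := sqrt_three_ofReal_sq
  have hr0 : ((√3 : ℝ) : ℂ) ≠ 0 := by simp
  rw [← sqrt_pi_ofReal_sq] at h1
  rw [airyC₂, h3, twelve_cpow_one_third]
  generalize (2 : ℂ) ^ (1 / 3 : ℂ) = α at *
  generalize (3 : ℂ) ^ (1 / 3 : ℂ) = β at *
  generalize ((√3 : ℝ) : ℂ) = r at *
  generalize ((√Real.pi : ℝ) : ℂ) = p at *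
  generalize Complex.Gamma (1 / 3) = G1 at *
  generalize Complex.Gamma (2 / 3) = G2 at *
  generalize Complex.Gamma (7 / 6) = G7 at *
  have key : r * p * α ^ 4 * G7 = G1 ^ 2 := by
    apply mul_left_cancel₀ (mul_ne_zero hG2 hr0)
    linear_combination (r ^ 2 * p * α ^ 3 / 3) * h2 + (r ^ 2 * p ^ 2 * G1 / 3) * hα
      + (2 * p ^ 2 * G1 / 3) * hr - G1 * h1
  field_simp
  linear_combination key

/-! ### `Ai` and `Bi` as Airy solutions. -/

theorem IsAirySolution.linearComb {u u' v v' : ℂ → ℂ} (hu : IsAirySolution u u')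
    (hv : IsAirySolution v v') (c d : ℂ) :
    IsAirySolution (fun z => c * u z + d * v z) (fun z => c * u' z + d * v' z) := by
  refine ⟨fun z => ((hu.hasDerivAt z).const_mul c).add ((hv.hasDerivAt z).const_mul d),
    fun z => ?_, fun ε hε => ?_⟩
  · convert! ((hu.hasDerivAt' z).const_mul c).add ((hv.hasDerivAt' z).const_mul d) using 1
    ring
  · obtain ⟨C, hC, h1⟩ := hu.growth ε hε
    obtain ⟨D, hD, h2⟩ := hv.growth ε hε
    refine ⟨‖c‖ * C + ‖d‖ * D, by positivity, fun z => (norm_add_le _ _).trans ?_⟩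
    rw [norm_mul, norm_mul, add_mul, mul_assoc, mul_assoc]
    gcongr
    · exact h1 z
    · exact h2 z

theorem exists_isAirySolution_airyAi : ∃ w : ℂ → ℂ, IsAirySolution airyAi w ∧
    airyAi 0 = airyC₁ ∧ w 0 = -airyC₂ := by
  have h := isAirySolution_airyAtomF.linearComb isAirySolution_airyAtomG airyC₁ (-airyC₂)
  have e : (fun z => airyC₁ * airyAtomF z + -airyC₂ * airyAtomG z) = airyAi := by
    funext z
    simp only [airyAi]
    ring
  rw [e] at h
  refine ⟨_, h, ?_, ?_⟩
  · simp [airyAi, airyAtomF, airyAtomG, hyp0F1_zero]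
  · simp [hyp0F1_zero]

theorem exists_isAirySolution_airyBi : ∃ w : ℂ → ℂ, IsAirySolution airyBi w ∧
    airyBi 0 = ((√3 : ℝ) : ℂ) * airyC₁ ∧ w 0 = ((√3 : ℝ) : ℂ) * airyC₂ := by
  have h := isAirySolution_airyAtomF.linearComb isAirySolution_airyAtomG
    (((√3 : ℝ) : ℂ) * airyC₁) (((√3 : ℝ) : ℂ) * airyC₂)
  have e : (fun z => ((√3 : ℝ) : ℂ) * airyC₁ * airyAtomF z + ((√3 : ℝ) : ℂ) * airyC₂ * airyAtomG z) = airyBi := by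
    funext z
    simp only [airyBi]
    ring
  rw [e] at h
  refine ⟨_, h, ?_, ?_⟩
  · simp [airyBi, airyAtomF, airyAtomG, hyp0F1_zero]
  · simp [hyp0F1_zero]

/-! ### The Bessel form. -/

theorem one_div_Gamma_mul_hyp0F1 {ν : ℂ} (hν : 0 < (ν + 1).re) (w : ℂ) :
    1 / Complex.Gamma (ν + 1) * hyp0F1 (ν + 1) (w ^ 2 / 4)
      = ∑' n : ℕ, (w ^ 2 / 4) ^ n / ((n.factorial : ℂ) * Complex.Gamma (ν + n + 1)) := by
  have hG : Complex.Gamma (ν + 1) ≠ 0 := Complex.Gamma_ne_zero_of_re_pos hν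
  rw [hyp0F1, ← tsum_mul_left]
  congr 1
  funext n
  have h : Complex.Gamma (ν + n + 1)
      = (ascPochhammer ℂ n).eval (ν + 1) * Complex.Gamma (ν + 1) := by
    induction n with
    | zero => simp
    | succ n ih =>
      have h0 : ν + n + 1 ≠ 0 := by
        intro h
        have : (ν + n + 1).re = (ν + 1).re + n := by simp; ring
        rw [h, Complex.zero_re] at this
        linarith [(Nat.cast_nonneg n : (0 : ℝ) ≤ n)]
      rw [ascPochhammer_succ_eval, Nat.cast_succ, ← add_assoc, Complex.Gamma_add_one _ h0, ih]
      ring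
  rw [h]
  simp only [div_eq_mul_inv, mul_inv]
  ring

/-- Principal powers of the same nonzero base cancel exactly, so no branch condition on `w` is
needed. -/
theorem one_div_Gamma_mul_hyp0F1_eq_besselI {ν w : ℂ} (hν : 0 < (ν + 1).re) (hw : w ≠ 0) :
    1 / Complex.Gamma (ν + 1) * hyp0F1 (ν + 1) (w ^ 2 / 4) = (w / 2) ^ (-ν) * besselI ν w := by
  rw [besselI, ← mul_assoc, ← Complex.cpow_add _ _ (div_ne_zero hw two_ne_zero), neg_add_cancel,
    Complex.cpow_zero, one_mul, one_div_Gamma_mul_hyp0F1 hν]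

/-! ### Assembly of the three integral formulas. -/

theorem mainTheorem5 :
    -- the two-parameter integral
    (∀ a b : ℂ,
      Integrable (fun t : ℝ => Complex.exp (-(t : ℂ) ^ 2) *
        (airyAi (2 * a * t - a * (a ^ 3 + 2 * b ^ 3)) * airyBi (2 * b * t - b * (2 * a ^ 3 + b ^ 3))
        + airyAi (2 * b * t - b * (2 * a ^ 3 + b ^ 3)) *
          airyBi (2 * a * t - a * (a ^ 3 + 2 * b ^ 3)))) ∧
      ∫ t : ℝ, Complex.exp (-(t : ℂ) ^ 2) *
        (airyAi (2 * a * t - a * (a ^ 3 + 2 * b ^ 3)) * airyBi (2 * b * t - b * (2 * a ^ 3 + b ^ 3))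
        + airyAi (2 * b * t - b * (2 * a ^ 3 + b ^ 3)) *
          airyBi (2 * a * t - a * (a ^ 3 + 2 * b ^ 3)))
      = 2 / (12 : ℂ) ^ (1 / 3 : ℂ) * Complex.exp (-(a ^ 3 + b ^ 3) ^ 2 / 3) *
        (1 / Complex.Gamma (5 / 6) * hyp0F1 (5 / 6) (4 / 9 * (a * b) ^ 6)
        - 2 * a * b / ((12 : ℂ) ^ (1 / 3 : ℂ) * Complex.Gamma (7 / 6)) *
          hyp0F1 (7 / 6) (4 / 9 * (a * b) ^ 6))) ∧
    -- the two hypergeometric functions as Bessel functions of order `-1/6` and `1/6`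
    (∀ a b : ℂ, a ≠ 0 → b ≠ 0 →
      1 / Complex.Gamma (5 / 6) * hyp0F1 (5 / 6) (4 / 9 * (a * b) ^ 6)
        = (2 / 3 * (a * b) ^ 3) ^ (1 / 6 : ℂ) * besselI (-(1 / 6)) (4 / 3 * (a * b) ^ 3) ∧
      1 / Complex.Gamma (7 / 6) * hyp0F1 (7 / 6) (4 / 9 * (a * b) ^ 6)
        = (2 / 3 * (a * b) ^ 3) ^ (-(1 / 6) : ℂ) * besselI (1 / 6) (4 / 3 * (a * b) ^ 3)) ∧
    -- the case `b = -a`: the product `Ai Bi`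
    (∀ a : ℂ,
      Integrable (fun t : ℝ => Complex.exp (-(t : ℂ) ^ 2) *
        (airyAi (2 * a * t + a ^ 4) * airyBi (-2 * a * t + a ^ 4))) ∧
      ∫ t : ℝ, Complex.exp (-(t : ℂ) ^ 2) *
        (airyAi (2 * a * t + a ^ 4) * airyBi (-2 * a * t + a ^ 4))
      = 1 / (12 : ℂ) ^ (1 / 3 : ℂ) *
        (1 / Complex.Gamma (5 / 6) * hyp0F1 (5 / 6) (4 / 9 * a ^ 12)
        + 2 * a ^ 2 / ((12 : ℂ) ^ (1 / 3 : ℂ) * Complex.Gamma (7 / 6)) *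
          hyp0F1 (7 / 6) (4 / 9 * a ^ 12))) ∧
    -- the case `b = -a`: the products `Bi Bi` and `Ai Ai`
    (∀ a : ℂ,
      Integrable (fun t : ℝ => Complex.exp (-(t : ℂ) ^ 2) *
        (airyBi (2 * a * t + a ^ 4) * airyBi (-2 * a * t + a ^ 4))) ∧
      Integrable (fun t : ℝ => Complex.exp (-(t : ℂ) ^ 2) *
        (airyAi (2 * a * t + a ^ 4) * airyAi (-2 * a * t + a ^ 4))) ∧
      ∫ t : ℝ, Complex.exp (-(t : ℂ) ^ 2) *
        (airyBi (2 * a * t + a ^ 4) * airyBi (-2 * a * t + a ^ 4))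
      = 3 * ∫ t : ℝ, Complex.exp (-(t : ℂ) ^ 2) *
        (airyAi (2 * a * t + a ^ 4) * airyAi (-2 * a * t + a ^ 4)) ∧
      3 * ∫ t : ℝ, Complex.exp (-(t : ℂ) ^ 2) *
        (airyAi (2 * a * t + a ^ 4) * airyAi (-2 * a * t + a ^ 4))
      = ((Real.sqrt 3 : ℝ) : ℂ) / (12 : ℂ) ^ (1 / 3 : ℂ) *
        (1 / Complex.Gamma (5 / 6) * hyp0F1 (5 / 6) (4 / 9 * a ^ 12)
        - 2 * a ^ 2 / ((12 : ℂ) ^ (1 / 3 : ℂ) * Complex.Gamma (7 / 6)) *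
          hyp0F1 (7 / 6) (4 / 9 * a ^ 12))) := by
  obtain ⟨A', hA, hA0, hA0'⟩ := exists_isAirySolution_airyAi
  obtain ⟨B', hB, hB0, hB0'⟩ := exists_isAirySolution_airyBi
  have h1 := airyC₁_sq
  have h2 := airyC₂_sq
  have hr := sqrt_three_ofReal_sq
  have e12 (a : ℂ) : (a * -a) ^ 6 = a ^ 12 := by ring
  have path (a t : ℂ) : 2 * a * t + -(a * (a ^ 3 + 2 * (-a) ^ 3)) = 2 * a * t + a ^ 4 := by ring
  have path' (a t : ℂ) : 2 * -a * t + -(-a * (2 * a ^ 3 + (-a) ^ 3)) = -2 * a * t + a ^ 4 := by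
    ring
  have e0 (a : ℂ) : Complex.exp (-(a ^ 3 + (-a) ^ 3) ^ 2 / 3) = 1 := by
    rw [← Complex.exp_zero]; congr 1; ring
  refine ⟨fun a b => ?_, fun a b ha hb => ?_, fun a => ⟨?_, ?_⟩, fun a => ⟨?_, ?_, ?_, ?_⟩⟩
  · have i1 := integrable_gaussian_airy hA.growth hB.growth hA.continuous hB.continuous (2 * a)
      (-(a * (a ^ 3 + 2 * b ^ 3))) (2 * b) (-(b * (2 * a ^ 3 + b ^ 3)))
    -- The second summand is the same integral with `Ai` and `Bi` exchanged. Its value depends only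
    -- on the products at `0`, so it equals the first, whence the factor 2.
    have i2 := integrable_gaussian_airy hB.growth hA.growth hB.continuous hA.continuous (2 * a)
      (-(a * (a ^ 3 + 2 * b ^ 3))) (2 * b) (-(b * (2 * a ^ 3 + b ^ 3)))
    have I1 := integral_gaussian_airy hA hB a b
    have I2 := integral_gaussian_airy hB hA a b
    rw [hA0, hB0, hA0', hB0'] at I1 I2
    simp only [sub_eq_add_neg, mul_add, mul_comm (airyAi (2 * b * _ + _))] at i1 i2 I1 I2 ⊢
    refine ⟨i1.add i2, ?_⟩
    rw [integral_add i1 i2, I1, I2]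
    linear_combination
      (2 * Complex.exp (-(a ^ 3 + b ^ 3) ^ 2 / 3) * hyp0F1 (5 / 6) (4 / 9 * (a * b) ^ 6)) * h1
      - (4 * a * b * Complex.exp (-(a ^ 3 + b ^ 3) ^ 2 / 3)
        * hyp0F1 (7 / 6) (4 / 9 * (a * b) ^ 6)) * h2
  · have hw : 4 / 3 * (a * b) ^ 3 ≠ 0 :=
      mul_ne_zero (by norm_num) (pow_ne_zero _ (mul_ne_zero ha hb))
    have e (x : ℂ) : (4 / 3 * x ^ 3) ^ 2 / 4 = 4 / 9 * x ^ 6 := by ring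
    have e' (x : ℂ) : 4 / 3 * x ^ 3 / 2 = 2 / 3 * x ^ 3 := by ring
    constructor
    · have h := one_div_Gamma_mul_hyp0F1_eq_besselI (ν := -(1 / 6)) (by norm_num) hw
      rwa [e, e', neg_neg, show (-(1 / 6) + 1 : ℂ) = 5 / 6 by norm_num] at h
    · have h := one_div_Gamma_mul_hyp0F1_eq_besselI (ν := 1 / 6) (by norm_num) hw
      rwa [e, e', show (1 / 6 + 1 : ℂ) = 7 / 6 by norm_num] at h
  · exact integrable_gaussian_airy hA.growth hB.growth hA.continuous hB.continuous _ _ _ _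
  -- For `b = -a` the Gaussian prefactor is 1 and `a b = -a²`, which with `Ai'(0) Bi'(0) < 0` makes
  -- the second term positive for real `a ≠ 0`.
  · have I := integral_gaussian_airy hA hB a (-a)
    simp only [path, path', e0, e12, hA0, hB0, hA0', hB0'] at I
    rw [I]
    linear_combination hyp0F1 (5 / 6) (4 / 9 * a ^ 12) * h1
      + (2 * a ^ 2 * hyp0F1 (7 / 6) (4 / 9 * a ^ 12)) * h2
  · exact integrable_gaussian_airy hB.growth hB.growth hB.continuous hB.continuous _ _ _ _
  · exact integrable_gaussian_airy hA.growth hA.growth hA.continuous hA.continuous _ _ _ _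
  -- The products at `0` are `3c₁²`, `3c₂²` for `Bi Bi` and `c₁²`, `c₂²` for `Ai Ai`: hence the
  -- ratio 3.
  · have I := integral_gaussian_airy hB hB a (-a)
    have J := integral_gaussian_airy hA hA a (-a)
    simp only [path, path', e0, e12, hA0, hB0, hA0', hB0'] at I J
    rw [I, J]
    linear_combination (((√Real.pi : ℝ) : ℂ) * (airyC₁ ^ 2 * hyp0F1 (5 / 6) (4 / 9 * a ^ 12)
      - 2 * airyC₂ ^ 2 * a ^ 2 * hyp0F1 (7 / 6) (4 / 9 * a ^ 12))) * hr
  · have J := integral_gaussian_airy hA hA a (-a)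
    simp only [path, path', e0, e12, hA0, hA0'] at J
    rw [J]
    linear_combination
      (((√3 : ℝ) : ℂ) * hyp0F1 (5 / 6) (4 / 9 * a ^ 12)) * h1
      - (((√3 : ℝ) : ℂ) * 2 * a ^ 2 * hyp0F1 (7 / 6) (4 / 9 * a ^ 12)) * h2
      - (((√Real.pi : ℝ) : ℂ) * (airyC₁ ^ 2 * hyp0F1 (5 / 6) (4 / 9 * a ^ 12)
      - 2 * airyC₂ ^ 2 * a ^ 2 * hyp0F1 (7 / 6) (4 / 9 * a ^ 12))) * hr
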